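/- Let $K\subset\mathbb C$ be a field, $\mathbf f=(f_1,\dots,f_N)\in K[\mathbf x]^N$ with $\mathbf x=(x_1,\dots,x_n)$, and let $\xi\in\mathbb C^n$ be an isolated solution of $\mathbf f$. Let $I=\langle f_1,\dots,f_N\rangle\subset\mathbb C[\mathbf x]$, let $\mathfrak m_\xi$ be the maximal ideal of $\xi$, and let $Q$ be the primary component of $I$ with $\sqrt Q=\mathfrak m_\xi$. *Dual space.* For $\beta\in\mathbb N^n$ let $\partial_\xi^\beta(p)=(\partial^\beta p)(\xi)$ and $\beta!=\beta_1!\cdots\beta_n!$. Let $\mathscr D$ be the space of all finite linear combinations $\Lambda$ of the functionals $\partial_\xi^\beta$ that vanish on $I$. Let $\mathrm{ord}(\Lambda)$ be the maximal $|\beta|$ such that $\partial_\xi^\beta$ occurs in $\Lambda$ with nonzero coefficient, let $\mathscr D_t$ be the set of elements of $\mathscr D$ of order at most $t$, and let $o$ be the smallest $t\ge 0$ with $\mathscr D_{t+1}=\mathscr D_t$. *Orthogonal primal-dual pair.* Let $\delta\ge 1$ and let $E=\{\alpha_0,\dots,\alpha_{\delta-1}\}\subset\mathbb N^n$ with $\alpha_0=0$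 be such that $B=\{(\mathbf x-\xi)^{\alpha_0},\dots,(\mathbf x-\xi)^{\alpha_{\delta-1}}\}$ is a basis of $\mathbb C[\mathbf x]/Q$ that is connected to $1$: every $\alpha_k\neq 0$ equals $\alpha_j+\mathbf e_i$ for some $j$ and some unit vector $\mathbf e_i$. Suppose that $\mathscr D$ has a basis $\Lambda_0,\dots,\Lambda_{\delta-1}$ with $\Lambda_0=1_\xi$ (evaluation at $\xi$), of the form $$\Lambda_i=\frac1{\alpha_i!}\partial_\xi^{\alpha_i}+\sum_{|\beta|\le o,\ \beta\notin E}\nu_{\alpha_i,\beta}\,\frac1{\beta!}\,\partial_\xi^{\beta}\qquad(0\le i\le\delta-1),$$ such that $0=\mathrm{ord}(\Lambda_0)\le\dots\le\mathrm{ord}(\Lambda_{\delta-1})$ and $\mathscr D_t=\mathrm{span}\{\Lambda_j:\mathrm{ord}(\Lambda_j)\le t\}$ for $0\le t\le o$. Put $\nu_{\alpha_i,\beta}=0$ for $\beta\notin E$ with $|\beta|>o$, so that $\nu_{\alpha_i,\beta}=\Lambda_i((\mathbf x-\xi)^\beta)$ for all $\beta\notin E$. *Parametric matrices.* Let $P$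 be the set of pairs $(\alpha_i,\beta)$ such that $\beta\notin E$ and $\beta=\alpha_k+\mathbf e_j$ for some $k<i$ and some $j$; take one variable $\mu_{\alpha,\beta}$ for each $(\alpha,\beta)\in P$, and let $\mathbb C[\mu]$ be the polynomial ring in these variables. For $1\le i\le n$ let $\mathtt M_i(\mu)$ be the strictly lower triangular $\delta\times\delta$ matrix over $\mathbb C[\mu]$ (so that $\mathtt M_i^t(\mu)$ is strictly upper triangular) with rows and columns indexed by $0,\dots,\delta-1$ whose entry in row $r$ and column $c<r$ is $1$ if $\alpha_r=\alpha_c+\mathbf e_i$; $0$ if $\alpha_c+\mathbf e_i\in E$ and $\alpha_r\ne\alpha_c+\mathbf e_i$; and $\mu_{\alpha_r,\alpha_c+\mathbf e_i}$ if $\alpha_c+\mathbf e_i\notin E$. Put $\mathtt M(\mu)^\gamma=\mathtt M_1(\mu)^{\gamma_1}\cdots\mathtt M_n(\mu)^{\gamma_n}$ (in this order) for $\gamma\in\mathbb N^n$ and $$\mathcal N_{\xi,\mu}(p)=\sum_{\gamma\in\mathbb N^n}\frac1{\gamma!}\,\partial_\xi^\gamma(p)\,\mathtt M(\mu)^\gamma[1]\in\mathbb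 C[\mu]^\delta,\qquad [1]=(1,0,\dots,0)^t .$$ **Theorem.** The ideal of $\mathbb C[\mu]$ generated by the entries of $\mathcal N_{\xi,\mu}(f_k)$ for $k=1,\dots,N$ and by the entries of $\mathtt M_i(\mu)\mathtt M_j(\mu)-\mathtt M_j(\mu)\mathtt M_i(\mu)$ for $i,j=1,\dots,n$ is equal to $$\mathfrak m_\nu=\bigl(\mu_{\alpha,\beta}-\nu_{\alpha,\beta}:\ (\alpha,\beta)\in P\bigr),$$ and this is a maximal ideal of $\mathbb C[\mu]$. -/

import Mathlib

open MvPolynomial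

noncomputable section

namespace MultStructure

/-! ### Solutions, the local component, the dual space -/

/-- The ideal `I` generated by the system `f`. -/
def sysIdeal {n N : ℕ} (f : Fin N → MvPolynomial (Fin n) ℂ) : Ideal (MvPolynomial (Fin n) ℂ) :=
  Ideal.span (Set.range f)

/-- `ξ` is a solution of `f` and some neighbourhood of `ξ` in `ℂⁿ` contains no other solution. -/
def IsIsolatedSolution {n N : ℕ} (f : Fin N → MvPolynomial (Fin n) ℂ) (ξ : Fin n → ℂ) : Prop :=
  (∀ k, eval ξ (f k) = 0) ∧
    ∃ U : Set (Fin n → ℂ), IsOpen U ∧ ξ ∈ U ∧ ∀ z ∈ U, (∀ k, eval z (f k) = 0) → z = ξ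

/-- The maximal ideal of the point `ξ`. -/
def pointIdeal {n : ℕ} (ξ : Fin n → ℂ) : Ideal (MvPolynomial (Fin n) ℂ) :=
  RingHom.ker (eval ξ)

/-- `Q` is a primary component of `I` (a member of a minimal primary decomposition of `I`)
whose radical is the maximal ideal of `ξ`. -/
def IsPrimaryComponentAt {n : ℕ} (I : Ideal (MvPolynomial (Fin n) ℂ)) (ξ : Fin n → ℂ)
    (Q : Ideal (MvPolynomial (Fin n) ℂ)) : Prop :=
  (∃ t : Finset (Ideal (MvPolynomial (Fin n) ℂ)),
    Submodule.IsMinimalPrimaryDecomposition I t ∧ Q ∈ t) ∧ Q.radical = pointIdeal ξ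

/-- `γ! = γ₁! ⋯ γₙ!`. -/
def multiFact {n : ℕ} (γ : Fin n →₀ ℕ) : ℕ := ∏ i, (γ i).factorial

/-- The iterated partial derivative `∂^γ = ∂₁^γ₁ ⋯ ∂ₙ^γₙ` on `ℂ[x]`. -/
def iterDeriv {n : ℕ} (γ : Fin n →₀ ℕ) : Module.End ℂ (MvPolynomial (Fin n) ℂ) :=
  ((List.finRange n).map fun i =>
    ((pderiv i : Derivation ℂ (MvPolynomial (Fin n) ℂ) (MvPolynomial (Fin n) ℂ)) :
      Module.End ℂ (MvPolynomial (Fin n) ℂ)) ^ γ i).prod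

/-- The functional `∂^β_ξ : p ↦ ∂^β(p)(ξ)`. -/
def derivAt {n : ℕ} (ξ : Fin n → ℂ) (β : Fin n →₀ ℕ) : Module.Dual ℂ (MvPolynomial (Fin n) ℂ) :=
  (aeval ξ : MvPolynomial (Fin n) ℂ →ₐ[ℂ] ℂ).toLinearMap ∘ₗ iterDeriv β

/-- An element `Λ = ∑ c_β ∂^β_ξ` of `ℂ[∂_ξ]` is represented by the polynomial `∑ c_β ∂^β`;
this is its value at `p`. The order of `Λ` is then its total degree. -/
def applyAt {n : ℕ} (ξ : Fin n → ℂ) (Λ p : MvPolynomial (Fin n) ℂ) : ℂ :=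
  ∑ β ∈ Λ.support, coeff β Λ * derivAt ξ β p

lemma applyAt_eq_sum {n : ℕ} (ξ : Fin n → ℂ) (Λ p : MvPolynomial (Fin n) ℂ)
    (s : Finset (Fin n →₀ ℕ)) (hs : Λ.support ⊆ s) :
    applyAt ξ Λ p = ∑ β ∈ s, coeff β Λ * derivAt ξ β p := by
  refine Finset.sum_subset hs fun β _ hβ => ?_
  rw [notMem_support_iff.mp hβ, zero_mul]

/-- `𝒟 = I^⊥ ∩ ℂ[∂_ξ]`. -/
def dualSpace {n : ℕ} (I : Ideal (MvPolynomial (Fin n) ℂ)) (ξ : Fin n → ℂ) :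
    Submodule ℂ (MvPolynomial (Fin n) ℂ) where
  carrier := {Λ | ∀ p ∈ I, applyAt ξ Λ p = 0}
  zero_mem' := fun p _ => by simp [applyAt]
  add_mem' := by
    intro a b ha hb p hp
    classical
    have h := applyAt_eq_sum ξ (a + b) p (a.support ∪ b.support) support_add
    have h1 := applyAt_eq_sum ξ a p (a.support ∪ b.support) Finset.subset_union_left
    have h2 := applyAt_eq_sum ξ b p (a.support ∪ b.support) Finset.subset_union_right
    rw [ha p hp] at h1
    rw [hb p hp] at h2
    rw [h]
    simp only [coeff_add, add_mul, Finset.sum_add_distrib]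
    rw [← h1, ← h2, add_zero]
  smul_mem' := by
    intro c a ha p hp
    have h := applyAt_eq_sum ξ (c • a) p a.support support_smul
    rw [h]
    simp only [coeff_smul, smul_eq_mul, mul_assoc, ← Finset.mul_sum]
    have h0 := ha p hp
    unfold applyAt at h0
    rw [h0, mul_zero]

/-- `𝒟_t`: the elements of `𝒟` of order at most `t`. -/
def dualSpaceLE {n : ℕ} (I : Ideal (MvPolynomial (Fin n) ℂ)) (ξ : Fin n → ℂ) (t : ℕ) :
    Submodule ℂ (MvPolynomial (Fin n) ℂ) :=
  dualSpace I ξ ⊓ restrictTotalDegree (Fin n) ℂ t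

/-- The nil-index `o`: the smallest `t` with `𝒟_{t+1} = 𝒟_t`. -/
def nilIndex {n : ℕ} (I : Ideal (MvPolynomial (Fin n) ℂ)) (ξ : Fin n → ℂ) : ℕ :=
  sInf {t | dualSpaceLE I ξ (t + 1) = dualSpaceLE I ξ t}

/-! ### Orthogonal primal-dual basis pairs -/

/-- The monomial `(x - ξ)^γ`. -/
def shiftedMonomial {n : ℕ} (ξ : Fin n → ℂ) (γ : Fin n →₀ ℕ) : MvPolynomial (Fin n) ℂ :=
  ∏ i, (X i - C (ξ i)) ^ γ i

/-- A set of exponents is connected to `1`: each nonzero member is obtained from another member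
by adding a unit vector. -/
def ConnectedToOne {n δ : ℕ} (α : Fin δ → Fin n →₀ ℕ) : Prop :=
  ∀ k, α k = 0 ∨ ∃ j i, α k = α j + Finsupp.single i 1

/-- The number `ν_{α_i,β}` : the coefficient of `(1/β!) ∂^β_ξ` in `Λ_i`,
i.e. the value of `Λ_i` at `(x - ξ)^β`. -/
def dualCoeff {n δ : ℕ} (Λ : Fin δ → MvPolynomial (Fin n) ℂ) (i : Fin δ) (β : Fin n →₀ ℕ) : ℂ :=
  (multiFact β : ℂ) * coeff β (Λ i)

/-- `(x - ξ)^{α_0}, …, (x - ξ)^{α_{δ-1}}` and `Λ_0, …, Λ_{δ-1}` form an orthogonal primal-dual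
basis pair of `ℂ[x]/Q` and `𝒟`. -/
structure IsOrthogonalPair {n δ : ℕ} [NeZero δ] (I Q : Ideal (MvPolynomial (Fin n) ℂ))
    (ξ : Fin n → ℂ) (α : Fin δ → Fin n →₀ ℕ) (Λ : Fin δ → MvPolynomial (Fin n) ℂ) : Prop where
  /-- the classes of the `(x - ξ)^{α_i}` form a basis of `ℂ[x]/Q` -/
  primal_indep : LinearIndependent ℂ fun i => Ideal.Quotient.mk Q (shiftedMonomial ξ (α i))
  primal_span : Submodule.span ℂ
    (Set.range fun i => Ideal.Quotient.mk Q (shiftedMonomial ξ (α i))) = ⊤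
  first : α 0 = 0
  connected : ConnectedToOne α
  /-- the `Λ_i` form a basis of `𝒟` -/
  dual_indep : LinearIndependent ℂ Λ
  dual_span : Submodule.span ℂ (Set.range Λ) = dualSpace I ξ
  dual_first : Λ 0 = 1
  /-- `Λ_i = (1/α_i!) ∂^{α_i} + ∑_{|β| ≤ o, β ∉ E} ν_{α_i,β} (1/β!) ∂^β` -/
  form : ∀ i j, coeff (α j) (Λ i) = if i = j then ((multiFact (α i) : ℂ))⁻¹ else 0
  form_le : ∀ i β, coeff β (Λ i) ≠ 0 → β.degree ≤ nilIndex I ξ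
  ord_first : (Λ 0).totalDegree = 0
  ord_mono : Monotone fun i => (Λ i).totalDegree
  ord_span : ∀ t ≤ nilIndex I ξ,
    dualSpaceLE I ξ t = Submodule.span ℂ {L | ∃ j, L = Λ j ∧ (Λ j).totalDegree ≤ t}

/-! ### Parametric multiplication matrices and the parametric normal form -/

/-- The indices `(α_i, β)` of the parameters `μ_{α_i,β}`: those with `β = α_k + e_j ∉ E` for
some `k < i` and some `j`, i.e. those which occur strictly below the diagonal of some `M_j(μ)`. -/
abbrev ParamIndex {n δ : ℕ} (α : Fin δ → Fin n →₀ ℕ) : Type :=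
  {p : Fin δ × (Fin n →₀ ℕ) //
    p.2 ∉ Set.range α ∧ ∃ k, k < p.1 ∧ ∃ j, p.2 = α k + Finsupp.single j 1}

open Classical in
/-- The parametric multiplication matrix `M_i(μ)`: strictly lower triangular, with entry
`μ_{α_r, α_c + e_i}` at row `r` and column `c < r`. -/
def paramMatrix {n δ : ℕ} (α : Fin δ → Fin n →₀ ℕ) (i : Fin n) :
    Matrix (Fin δ) (Fin δ) (MvPolynomial (ParamIndex α) ℂ) :=
  Matrix.of fun r c =>
    if hrc : c < r then
      if α r = α c + Finsupp.single i 1 then 1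
      else if h : α c + Finsupp.single i 1 ∈ Set.range α then 0
      else X ⟨(r, α c + Finsupp.single i 1), h, c, hrc, i, rfl⟩
    else 0

/-- `M(μ)^γ = M_1(μ)^γ₁ ⋯ M_n(μ)^γₙ`, in this order. -/
def paramMatrixPow {n δ : ℕ} (α : Fin δ → Fin n →₀ ℕ) (γ : Fin n →₀ ℕ) :
    Matrix (Fin δ) (Fin δ) (MvPolynomial (ParamIndex α) ℂ) :=
  ((List.finRange n).map fun i => paramMatrix α i ^ γ i).prod

/-- The parametric normal form
`N_{ξ,μ}(p) = ∑_γ (1/γ!) ∂^γ_ξ(p) M(μ)^γ [1]` with `[1] = (1, 0, …, 0)`. -/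
def paramNormalForm {n δ : ℕ} [NeZero δ] (α : Fin δ → Fin n →₀ ℕ) (ξ : Fin n → ℂ)
    (p : MvPolynomial (Fin n) ℂ) : Fin δ → MvPolynomial (ParamIndex α) ℂ :=
  ∑ᶠ γ : Fin n →₀ ℕ,
    ((multiFact γ : ℂ)⁻¹ * derivAt ξ γ p) •
      (paramMatrixPow α γ).mulVec (Pi.single 0 1)

/-- Only finitely many derivatives of a polynomial are nonzero, so that the sum which defines
`paramNormalForm` is a finite one. -/
lemma finite_iterDeriv_ne_zero {n : ℕ} (p : MvPolynomial (Fin n) ℂ) :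
    {γ : Fin n →₀ ℕ | iterDeriv γ p ≠ 0}.Finite := by
  have key1 : ∀ (i : Fin n) (k : ℕ) (q : MvPolynomial (Fin n) ℂ) (m : Fin n →₀ ℕ),
      ∃ c : ℂ, coeff m ((((pderiv i : Derivation ℂ (MvPolynomial (Fin n) ℂ)
        (MvPolynomial (Fin n) ℂ)) : Module.End ℂ (MvPolynomial (Fin n) ℂ)) ^ k) q) =
        c * coeff (m + Finsupp.single i k) q := by
    intro i k
    induction k with
    | zero => intro q m; exact ⟨1, by simp⟩
    | succ k ih =>
      intro q m
      rw [pow_succ, Module.End.mul_apply]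
      obtain ⟨c, hc⟩ := ih (pderiv i q) m
      refine ⟨c * ((m + Finsupp.single i k) i + 1 : ℕ), ?_⟩
      refine hc.trans ?_
      rw [coeff_pderiv, Finsupp.single_add, ← add_assoc]
      push_cast
      ring
  have key2 : ∀ (γ : Fin n →₀ ℕ) (l : List (Fin n)) (q : MvPolynomial (Fin n) ℂ)
      (m : Fin n →₀ ℕ), ∃ c : ℂ, coeff m ((l.map fun i =>
        ((pderiv i : Derivation ℂ (MvPolynomial (Fin n) ℂ) (MvPolynomial (Fin n) ℂ)) :
          Module.End ℂ (MvPolynomial (Fin n) ℂ)) ^ γ i).prod q) =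
        c * coeff (m + (l.map fun i => Finsupp.single i (γ i)).sum) q := by
    intro γ l
    induction l with
    | nil => intro q m; exact ⟨1, by simp⟩
    | cons a l ih =>
      intro q m
      rw [List.map_cons, List.prod_cons, Module.End.mul_apply]
      obtain ⟨c, hc⟩ := key1 a (γ a) _ m
      obtain ⟨d, hd⟩ := ih q (m + Finsupp.single a (γ a))
      refine ⟨c * d, ?_⟩
      rw [hc, hd, List.map_cons, List.sum_cons, add_assoc, mul_assoc]
  refine ((p.support.finite_toSet.biUnion fun s _ => Set.finite_Iic s)).subset ?_
  intro γ hγ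
  obtain ⟨m, hm⟩ := ne_zero_iff.mp hγ
  obtain ⟨c, hc⟩ := key2 γ (List.finRange n) p m
  have hsum : ((List.finRange n).map fun i => Finsupp.single i (γ i)).sum = γ := by
    rw [← List.ofFn_eq_map, List.sum_ofFn]
    exact Finsupp.univ_sum_single γ
  rw [hsum] at hc
  have hne : coeff (m + γ) p ≠ 0 := by
    intro h0
    rw [h0, mul_zero] at hc
    exact hm hc
  simp only [Set.mem_iUnion]
  exact ⟨m + γ, by simpa using hne, by simp⟩

/-- The ideal generated by the entries of the `N_{ξ,μ}(f_k)` and of the commutators of the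
parametric multiplication matrices. -/
def structureIdeal {n N δ : ℕ} [NeZero δ] (f : Fin N → MvPolynomial (Fin n) ℂ)
    (ξ : Fin n → ℂ) (α : Fin δ → Fin n →₀ ℕ) : Ideal (MvPolynomial (ParamIndex α) ℂ) :=
  Ideal.span
    ({g | ∃ k r, g = paramNormalForm α ξ (f k) r} ∪
      {g | ∃ i j r c,
        g = (paramMatrix α i * paramMatrix α j - paramMatrix α j * paramMatrix α i) r c})

/-- The ideal `m_ν` generated by the `μ_{α_i,β} - ν_{α_i,β}`. -/
def paramPointIdeal {n δ : ℕ} (α : Fin δ → Fin n →₀ ℕ) (Λ : Fin δ → MvPolynomial (Fin n) ℂ) :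
    Ideal (MvPolynomial (ParamIndex α) ℂ) :=
  Ideal.span (Set.range fun v : ParamIndex α => X v - C (dualCoeff Λ v.1.1 v.1.2))

end MultStructure

end

/-! Identify a functional `Λ` with its values on the powers `(x - ξ)^γ`, which are the numbers
`scaledCoeff γ Λ`. Multiplying the argument by `x_i - ξ_i` then amounts to differentiating `Λ`
(`applyAt_pderiv`), so the dual space is stable under derivatives. Derivatives lower the order,
hence the multiplication matrices in the dual basis are strictly lower triangular.

At `μ = ν` the parametric matrices are these multiplication matrices: they commute, `M^γ[1]` is the
vector of values `Λ_r((x - ξ)^γ)`, and row `r` of the normal form of `f_k` is `Λ_r(f_k) = 0`. So the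
structure ideal lies in `m_ν`.

Conversely, let `A` be the quotient of `ℂ[μ]` by the structure ideal. Over `A` the matrices commute
and the normal form kills the whole ideal of the system. Any `ℂ`-linear form on `A^δ` composed with
the normal form is therefore an element of the dual space, and expanding it in the `Λ_j` gives
`M^γ[1] = ∑_j Λ_j((x - ξ)^γ) M^{α_j}[1]` (`specVec_eq_sum`). Connectedness to `1` gives `M^{α_j}[1]
= e_j` (`specVec_basis`). Taking `γ = α_c + e_i` and reading row `r` yields `μ = ν` in `A`. -/

set_option linter.unusedSectionVars false

namespace MultStructure

variable {n δ : ℕ}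

/-! ### Taylor coefficients -/

/-- The linear form `q ↦ γ! · coeff γ q`. -/
noncomputable def scaledCoeff (γ : Fin n →₀ ℕ) : MvPolynomial (Fin n) ℂ →ₗ[ℂ] ℂ :=
  (multiFact γ : ℂ) • lcoeff ℂ γ

lemma scaledCoeff_apply (γ : Fin n →₀ ℕ) (q : MvPolynomial (Fin n) ℂ) :
    scaledCoeff γ q = (multiFact γ : ℂ) * coeff γ q := rfl

lemma multiFact_ne_zero (γ : Fin n →₀ ℕ) : (multiFact γ : ℂ) ≠ 0 := by
  rw [Nat.cast_ne_zero, multiFact, Finset.prod_ne_zero_iff]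
  exact fun i _ => Nat.factorial_ne_zero _

lemma multiFact_add_single (γ : Fin n →₀ ℕ) (i : Fin n) :
    multiFact (γ + Finsupp.single i 1) = (γ i + 1) * multiFact γ := by
  unfold multiFact
  rw [← Finset.mul_prod_erase _ _ (Finset.mem_univ i),
    ← Finset.mul_prod_erase Finset.univ (fun j => (γ j).factorial) (Finset.mem_univ i), ← mul_assoc]
  congr 1
  · simp [Nat.factorial_succ]
  · refine Finset.prod_congr rfl fun j hj => ?_
    have : i ≠ j := (Finset.ne_of_mem_erase hj).symm
    simp [this]

/-- The factor `γ!` absorbs the exponent produced by differentiation, leaving a pure index shift. -/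
lemma scaledCoeff_pderiv (γ : Fin n →₀ ℕ) (i : Fin n) (q : MvPolynomial (Fin n) ℂ) :
    scaledCoeff γ (pderiv i q) = scaledCoeff (γ + Finsupp.single i 1) q := by
  rw [scaledCoeff_apply, scaledCoeff_apply, coeff_pderiv, multiFact_add_single]
  push_cast
  ring

lemma scaledCoeff_iterDeriv (m γ : Fin n →₀ ℕ) (q : MvPolynomial (Fin n) ℂ) :
    scaledCoeff m (iterDeriv γ q) = scaledCoeff (m + γ) q := by
  have key1 : ∀ (i : Fin n) (k : ℕ) (q : MvPolynomial (Fin n) ℂ) (m : Fin n →₀ ℕ),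
      scaledCoeff m ((((pderiv i : Derivation ℂ (MvPolynomial (Fin n) ℂ)
        (MvPolynomial (Fin n) ℂ)) : Module.End ℂ (MvPolynomial (Fin n) ℂ)) ^ k) q) =
        scaledCoeff (m + Finsupp.single i k) q := by
    intro i k
    induction k with
    | zero => intro q m; simp
    | succ k ih =>
      intro q m
      rw [pow_succ, Module.End.mul_apply, ih, Finsupp.single_add, ← add_assoc]
      exact scaledCoeff_pderiv _ _ _
  have key2 : ∀ (l : List (Fin n)) (q : MvPolynomial (Fin n) ℂ) (m : Fin n →₀ ℕ),
      scaledCoeff m ((l.map fun i =>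
        ((pderiv i : Derivation ℂ (MvPolynomial (Fin n) ℂ) (MvPolynomial (Fin n) ℂ)) :
          Module.End ℂ (MvPolynomial (Fin n) ℂ)) ^ γ i).prod q) =
        scaledCoeff (m + (l.map fun i => Finsupp.single i (γ i)).sum) q := by
    intro l
    induction l with
    | nil => intro q m; simp
    | cons a l ih =>
      intro q m
      rw [List.map_cons, List.prod_cons, Module.End.mul_apply, key1, ih, List.map_cons,
        List.sum_cons, add_assoc]
  have hsum : ((List.finRange n).map fun i => Finsupp.single i (γ i)).sum = γ := by
    rw [← List.ofFn_eq_map, List.sum_ofFn]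
    exact Finsupp.univ_sum_single γ
  rw [iterDeriv, key2, hsum]

/-- The substitution `p ↦ p(x + ξ)`. -/
noncomputable def translate (ξ : Fin n → ℂ) :
    MvPolynomial (Fin n) ℂ →ₐ[ℂ] MvPolynomial (Fin n) ℂ :=
  aeval fun i => X i + C (ξ i)

lemma translate_pderiv (ξ : Fin n → ℂ) (i : Fin n) (p : MvPolynomial (Fin n) ℂ) :
    translate ξ (pderiv i p) = pderiv i (translate ξ p) := by
  induction p using MvPolynomial.induction_on with
  | C a => simp [translate]
  | add p q hp hq => simp only [map_add, hp, hq]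
  | mul_X p j hp =>
    have hX : translate ξ (X j) = X j + C (ξ j) := by simp [translate]
    have h1 : translate ξ (pderiv i (X j)) = pderiv i (X j + C (ξ j)) := by
      by_cases h : i = j
      · subst h
        simp
      · simp [pderiv_X_of_ne (Ne.symm h)]
    simp only [Derivation.leibniz, smul_eq_mul, map_add, map_mul, hp, hX] at h1 ⊢
    rw [h1]

lemma translate_iterDeriv (ξ : Fin n → ℂ) (γ : Fin n →₀ ℕ) (p : MvPolynomial (Fin n) ℂ) :
    translate ξ (iterDeriv γ p) = iterDeriv γ (translate ξ p) := by
  have key : ∀ i, Commute (translate ξ).toLinearMap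
      ((pderiv i : Derivation ℂ (MvPolynomial (Fin n) ℂ) (MvPolynomial (Fin n) ℂ)) :
          Module.End ℂ (MvPolynomial (Fin n) ℂ)) :=
    fun i => LinearMap.ext fun p => translate_pderiv ξ i p
  have h : Commute (translate ξ).toLinearMap (iterDeriv γ) := by
    refine Commute.list_prod_right _ _ fun x hx => ?_
    obtain ⟨i, -, rfl⟩ := List.mem_map.mp hx
    exact (key i).pow_right _
  exact LinearMap.congr_fun h.eq p

/-- Taylor's formula: `∂^γ_ξ(p)` is `γ!` times a coefficient of `p(x + ξ)`. -/
lemma derivAt_eq_scaledCoeff (ξ : Fin n → ℂ) (γ : Fin n →₀ ℕ) (p : MvPolynomial (Fin n) ℂ) :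
    derivAt ξ γ p = scaledCoeff γ (translate ξ p) := by
  have h0 : ∀ q, aeval ξ q = scaledCoeff 0 (translate ξ q) := by
    intro q
    have h1 : aeval ξ q = constantCoeff (translate ξ q) := by
      induction q using MvPolynomial.induction_on with
      | C a => simp [translate]
      | add p q hp hq => simp only [map_add, hp, hq]
      | mul_X p j hp =>
        rw [map_mul, map_mul, map_mul, hp]
        simp [translate]
    simp [h1, scaledCoeff_apply, multiFact, constantCoeff_eq]
  rw [derivAt, LinearMap.comp_apply, AlgHom.toLinearMap_apply, h0, translate_iterDeriv,
    scaledCoeff_iterDeriv, zero_add]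

/-! ### Linear maps given on monomials -/

section EvalSeq

variable {V W : Type*} [AddCommGroup V] [Module ℂ V] [AddCommGroup W] [Module ℂ W]

/-- The linear map with `x^γ ↦ u γ`. -/
noncomputable def evalSeq (u : (Fin n →₀ ℕ) → V) : MvPolynomial (Fin n) ℂ →ₗ[ℂ] V :=
  (basisMonomials (Fin n) ℂ).constr ℂ u

lemma evalSeq_monomial (u : (Fin n →₀ ℕ) → V) (γ : Fin n →₀ ℕ) (c : ℂ) :
    evalSeq u (monomial γ c) = c • u γ := by
  have h : (monomial γ c : MvPolynomial (Fin n) ℂ) = c • basisMonomials (Fin n) ℂ γ := by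
    simp [smul_monomial]
  rw [h, map_smul, evalSeq, Module.Basis.constr_basis]

lemma evalSeq_eq_sum (u : (Fin n →₀ ℕ) → V) (q : MvPolynomial (Fin n) ℂ)
    (s : Finset (Fin n →₀ ℕ)) (hs : ∀ γ ∉ s, coeff γ q • u γ = 0) :
    evalSeq u q = ∑ γ ∈ s, coeff γ q • u γ := by
  classical
  have h1 : evalSeq u q = ∑ γ ∈ q.support, coeff γ q • u γ := by
    conv_lhs => rw [q.as_sum, map_sum]
    simp only [evalSeq_monomial]
  rw [h1]
  have h2 : ∑ γ ∈ q.support, coeff γ q • u γ = ∑ γ ∈ q.support ∪ s, coeff γ q • u γ :=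
    Finset.sum_subset Finset.subset_union_left fun γ _ h => by
      rw [notMem_support_iff.mp h, zero_smul]
  have h3 : ∑ γ ∈ s, coeff γ q • u γ = ∑ γ ∈ q.support ∪ s, coeff γ q • u γ :=
    Finset.sum_subset Finset.subset_union_right fun γ _ h => hs γ h
  rw [h2, h3]

lemma map_evalSeq (l : V →ₗ[ℂ] W) (u : (Fin n →₀ ℕ) → V) (q : MvPolynomial (Fin n) ℂ) :
    l (evalSeq u q) = evalSeq (fun γ => l (u γ)) q := by
  induction q using MvPolynomial.induction_on' with
  | monomial γ c => simp only [evalSeq_monomial, map_smul]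
  | add p q hp hq => simp only [map_add, hp, hq]

lemma evalSeq_X_mul (u : (Fin n →₀ ℕ) → V) (i : Fin n) (q : MvPolynomial (Fin n) ℂ) :
    evalSeq u (X i * q) = evalSeq (fun γ => u (γ + Finsupp.single i 1)) q := by
  induction q using MvPolynomial.induction_on' with
  | monomial γ c =>
    rw [mul_comm, X, monomial_mul, mul_one, evalSeq_monomial, evalSeq_monomial]
  | add p q hp hq => simp only [mul_add, map_add, hp, hq]

/-- The operator `T i` realizes multiplication by `X i` on the values, so the kernel of `evalSeq u`
is an ideal. -/
lemma evalSeq_mul_eq_zero {u : (Fin n →₀ ℕ) → V} {T : Fin n → V →ₗ[ℂ] V}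
    (hT : ∀ i γ, T i (u γ) = u (γ + Finsupp.single i 1))
    {q : MvPolynomial (Fin n) ℂ} (hq : evalSeq u q = 0) (s : MvPolynomial (Fin n) ℂ) :
    evalSeq u (s * q) = 0 := by
  induction s using MvPolynomial.induction_on with
  | C a => rw [C_mul', map_smul, hq, smul_zero]
  | add p q hp hq => rw [add_mul, map_add, hp, hq, add_zero]
  | mul_X p i hp =>
    rw [mul_right_comm, mul_comm, evalSeq_X_mul]
    simp only [← hT]
    rw [← map_evalSeq, hp, map_zero]

/-- If `u` is a sequence on which the operators `T i` act as shifts, then the map `p(x + ξ) ↦ u`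
vanishes on the ideal of a system as soon as it vanishes on the system. -/
lemma evalSeq_translate_eq_zero {N : ℕ} {f : Fin N → MvPolynomial (Fin n) ℂ} {ξ : Fin n → ℂ}
    {u : (Fin n →₀ ℕ) → V} {T : Fin n → V →ₗ[ℂ] V}
    (hT : ∀ i γ, T i (u γ) = u (γ + Finsupp.single i 1))
    (hf : ∀ k, evalSeq u (translate ξ (f k)) = 0) {p : MvPolynomial (Fin n) ℂ}
    (hp : p ∈ sysIdeal f) : evalSeq u (translate ξ p) = 0 := by
  induction hp using Submodule.span_induction with
  | mem x hx => obtain ⟨k, rfl⟩ := hx; exact hf k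
  | zero => simp
  | add x y _ _ hx hy => rw [map_add, map_add, hx, hy, add_zero]
  | smul a x _ hx =>
    rw [smul_eq_mul, map_mul]
    exact evalSeq_mul_eq_zero hT hx _

end EvalSeq

lemma applyAt_eq_evalSeq (ξ : Fin n → ℂ) (L p : MvPolynomial (Fin n) ℂ) :
    applyAt ξ L p = evalSeq (fun γ => scaledCoeff γ L) (translate ξ p) := by
  rw [evalSeq_eq_sum _ _ L.support fun γ hγ => by
    rw [scaledCoeff_apply, notMem_support_iff.mp hγ, mul_zero, smul_zero]]
  refine Finset.sum_congr rfl fun γ _ => ?_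
  rw [derivAt_eq_scaledCoeff, scaledCoeff_apply, scaledCoeff_apply, smul_eq_mul]
  ring

/-- Differentiation of functionals is the transpose of multiplication by `x_i - ξ_i`: both shift the
index by `e_i`. -/
lemma applyAt_pderiv (ξ : Fin n → ℂ) (i : Fin n) (L p : MvPolynomial (Fin n) ℂ) :
    applyAt ξ (pderiv i L) p = applyAt ξ L ((X i - C (ξ i)) * p) := by
  have h : translate ξ (X i - C (ξ i)) = X i := by simp [translate]
  rw [applyAt_eq_evalSeq, applyAt_eq_evalSeq, map_mul, h, evalSeq_X_mul]
  simp only [scaledCoeff_pderiv]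

lemma pderiv_mem_dualSpace {I : Ideal (MvPolynomial (Fin n) ℂ)} {ξ : Fin n → ℂ}
    {L : MvPolynomial (Fin n) ℂ} (hL : L ∈ dualSpace I ξ) (i : Fin n) :
    pderiv i L ∈ dualSpace I ξ := fun p hp => by
  rw [applyAt_pderiv]
  exact hL _ (I.mul_mem_left _ hp)

lemma degree_le_totalDegree {p : MvPolynomial (Fin n) ℂ} {γ : Fin n →₀ ℕ}
    (h : coeff γ p ≠ 0) : γ.degree ≤ p.totalDegree := by
  have := le_totalDegree (mem_support_iff.mpr h)
  rwa [Finsupp.sum_fintype _ _ (fun _ => rfl), ← Finsupp.degree_eq_sum] at this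

lemma totalDegree_le_of_degree_le {p : MvPolynomial (Fin n) ℂ} {t : ℕ}
    (h : ∀ γ, coeff γ p ≠ 0 → γ.degree ≤ t) : p.totalDegree ≤ t := by
  refine Finset.sup_le fun γ hγ => ?_
  have := h γ (mem_support_iff.mp hγ)
  rwa [Finsupp.sum_fintype _ _ (fun _ => rfl), ← Finsupp.degree_eq_sum]

lemma totalDegree_pderiv_le_pred (i : Fin n) (p : MvPolynomial (Fin n) ℂ) :
    (pderiv i p).totalDegree ≤ p.totalDegree - 1 := by
  refine totalDegree_le_of_degree_le fun γ hγ => ?_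
  rw [coeff_pderiv] at hγ
  have h := degree_le_totalDegree (left_ne_zero_of_mul hγ)
  rw [map_add, Finsupp.degree_single] at h
  omega

/-! ### The orthogonal pair -/

section Pair

variable [NeZero δ] {I Q : Ideal (MvPolynomial (Fin n) ℂ)} {ξ : Fin n → ℂ}
  {α : Fin δ → Fin n →₀ ℕ} {Λ : Fin δ → MvPolynomial (Fin n) ℂ}

namespace IsOrthogonalPair

lemma scaledCoeff_dual (h : IsOrthogonalPair I Q ξ α Λ) (i j : Fin δ) :
    scaledCoeff (α j) (Λ i) = if i = j then 1 else 0 := by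
  rw [scaledCoeff_apply, h.form]
  split_ifs with hij
  · subst hij
    exact mul_inv_cancel₀ (multiFact_ne_zero _)
  · exact mul_zero _

lemma injective (h : IsOrthogonalPair I Q ξ α Λ) : Function.Injective α := by
  intro i j hij
  by_contra hne
  have h1 := h.scaledCoeff_dual i j
  rw [← hij, h.scaledCoeff_dual i i, if_pos rfl, if_neg hne] at h1
  exact one_ne_zero h1

lemma dual_mem (h : IsOrthogonalPair I Q ξ α Λ) (j : Fin δ) : Λ j ∈ dualSpace I ξ := by
  rw [← h.dual_span]
  exact Submodule.subset_span ⟨j, rfl⟩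

/-- The expansion of an element of the dual space in the dual basis. -/
lemma scaledCoeff_expand (h : IsOrthogonalPair I Q ξ α Λ) {L : MvPolynomial (Fin n) ℂ}
    (hL : L ∈ dualSpace I ξ) (β : Fin n →₀ ℕ) :
    scaledCoeff β L = ∑ j, scaledCoeff (α j) L * scaledCoeff β (Λ j) := by
  rw [← h.dual_span] at hL
  induction hL using Submodule.span_induction with
  | mem x hx =>
    obtain ⟨i, rfl⟩ := hx
    simp [h.scaledCoeff_dual]
  | zero => simp
  | add x y _ _ hx hy => simp only [map_add, add_mul, Finset.sum_add_distrib, ← hx, ← hy]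
  | smul a x _ hx => simp only [map_smul, smul_eq_mul, mul_assoc, ← Finset.mul_sum, ← hx]

/-- The multiplication matrices of the dual basis are strictly lower triangular. -/
lemma scaledCoeff_succ_eq_zero (h : IsOrthogonalPair I Q ξ α Λ) {r c : Fin δ} (hrc : r ≤ c)
    (i : Fin n) : scaledCoeff (α c + Finsupp.single i 1) (Λ r) = 0 := by
  rw [← scaledCoeff_pderiv]
  -- Order `0` is separate: there the truncated `totalDegree - 1` would not be a strict drop.
  rcases Nat.eq_zero_or_pos (Λ r).totalDegree with h0 | hpos
  · rw [scaledCoeff_pderiv, scaledCoeff_apply]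
    by_contra hne
    have h1 := degree_le_totalDegree (right_ne_zero_of_mul hne)
    rw [map_add, Finsupp.degree_single] at h1
    omega
  have hle : (Λ r).totalDegree ≤ nilIndex I ξ := totalDegree_le_of_degree_le (h.form_le r)
  have hmem : pderiv i (Λ r) ∈ dualSpaceLE I ξ ((Λ r).totalDegree - 1) :=
    ⟨pderiv_mem_dualSpace (h.dual_mem r) i,
      (mem_restrictTotalDegree _ _ _).mpr (totalDegree_pderiv_le_pred i _)⟩
  -- The derivative is a combination of `Λ_j` of order below that of `Λ_r`; as orders increase and
  -- `r ≤ c`, `Λ_c` is not among them, and orthogonality gives `0` at `α_c`.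
  rw [h.ord_span _ (by omega)] at hmem
  generalize pderiv i (Λ r) = q at hmem
  induction hmem using Submodule.span_induction with
  | mem x hx =>
    obtain ⟨j, rfl, hj⟩ := hx
    rw [h.scaledCoeff_dual, if_neg]
    rintro rfl
    have := h.ord_mono hrc
    simp only at this
    omega
  | zero => simp
  | add x y _ _ hx hy => rw [map_add, hx, hy, add_zero]
  | smul a x _ hx => rw [map_smul, hx, smul_zero]

end IsOrthogonalPair

/-! ### Specializations of the parametric matrices -/

variable {A : Type*} [CommRing A] [Algebra ℂ A] (φ : MvPolynomial (ParamIndex α) ℂ →ₐ[ℂ] A)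

/-- The vector `M^γ[1]` for the matrices specialized along `φ`. -/
noncomputable def specVec (γ : Fin n →₀ ℕ) : Fin δ → A :=
  fun r => φ ((paramMatrixPow α γ).mulVec (Pi.single 0 1) r)

lemma specVec_eq_mulVec (γ : Fin n →₀ ℕ) :
    specVec φ γ =
      ((List.finRange n).map fun i => (paramMatrix α i).map φ ^ γ i).prod.mulVec
        (Pi.single 0 1) := by
  have h1 : ((List.finRange n).map fun i => (paramMatrix α i).map φ ^ γ i).prod =
      (paramMatrixPow α γ).map φ := by
    have := map_list_prod (φ.toRingHom.mapMatrix (m := Fin δ))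
      ((List.finRange n).map fun i => paramMatrix α i ^ γ i)
    simp only [List.map_map, Function.comp_def, map_pow] at this
    exact this.symm
  rw [h1]
  funext r
  simp [specVec]

lemma specVec_zero : specVec φ 0 = Pi.single 0 1 := by
  have h1 : ((List.finRange n).map fun i =>
      (paramMatrix α i).map φ ^ (0 : Fin n →₀ ℕ) i).prod = 1 :=
    List.prod_eq_one fun x hx => by
      obtain ⟨i, -, rfl⟩ := List.mem_map.mp hx
      exact pow_zero _
  rw [specVec_eq_mulVec, h1, Matrix.one_mulVec]

/-- Commutativity moves the extra factor `M_i` through the ordered product to its own slot. -/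
lemma specVec_add_single
    (hcomm : ∀ i j, Commute ((paramMatrix α i).map φ) ((paramMatrix α j).map φ))
    (i : Fin n) (γ : Fin n →₀ ℕ) :
    ((paramMatrix α i).map φ).mulVec (specVec φ γ) = specVec φ (γ + Finsupp.single i 1) := by
  have key : ∀ l : List (Fin n), l.Nodup → i ∈ l →
      (paramMatrix α i).map φ * (l.map fun j => (paramMatrix α j).map φ ^ γ j).prod =
        (l.map fun j => (paramMatrix α j).map φ ^ (γ + Finsupp.single i 1 : Fin n →₀ ℕ) j).prod := by
    intro l
    induction l with
    | nil => simp
    | cons a l ih =>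
      intro hl hi
      rw [List.nodup_cons] at hl
      simp only [List.map_cons, List.prod_cons]
      by_cases hia : i = a
      · subst hia
        rw [← mul_assoc, ← pow_succ']
        congr 2
        · simp
        · refine List.map_congr_left fun j hj => ?_
          have : i ≠ j := fun h => hl.1 (h ▸ hj)
          simp [this]
      · have hi' : i ∈ l := (List.mem_cons.mp hi).resolve_left hia
        rw [← ih hl.2 hi', ← mul_assoc, ((hcomm i a).pow_right _).eq, mul_assoc]
        simp [hia]
  rw [specVec_eq_mulVec, specVec_eq_mulVec, Matrix.mulVec_mulVec,
    key _ (List.nodup_finRange n) (List.mem_finRange i)]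

lemma paramMatrix_eq_zero (i : Fin n) {r c : Fin δ} (h : r ≤ c) : paramMatrix α i r c = 0 := by
  simp [paramMatrix, not_lt.mpr h]

/-- Each strictly lower triangular factor pushes the first nonzero coordinate down by at least one
row. Hence `M^γ[1] = 0` once `|γ| ≥ δ`. -/
lemma specVec_eq_zero_of_lt_degree
    (hcomm : ∀ i j, Commute ((paramMatrix α i).map φ) ((paramMatrix α j).map φ))
    {γ : Fin n →₀ ℕ} {r : Fin δ} (h : (r : ℕ) < γ.degree) : specVec φ γ r = 0 := by
  induction hd : γ.degree generalizing γ r with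
  | zero => omega
  | succ d ih =>
    have hne : γ ≠ 0 := by rintro rfl; simp at hd
    obtain ⟨i, hi⟩ := Finsupp.ne_iff.mp hne
    have hle : Finsupp.single i 1 ≤ γ := by
      rw [Finsupp.single_le_iff]
      exact Nat.one_le_iff_ne_zero.mpr hi
    obtain ⟨γ', rfl⟩ := exists_add_of_le hle
    rw [add_comm] at hd h ⊢
    rw [map_add, Finsupp.degree_single] at hd
    rw [← specVec_add_single φ hcomm, Matrix.mulVec, dotProduct]
    refine Finset.sum_eq_zero fun c _ => ?_
    rcases le_or_gt r c with hrc | hrc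
    · rw [Matrix.map_apply, paramMatrix_eq_zero i hrc, map_zero, zero_mul]
    · rw [ih (γ := γ') (r := c) _ (by omega), mul_zero]
      rw [map_add, Finsupp.degree_single] at h
      have := Fin.lt_def.mp hrc
      omega

/-- By Taylor's formula the specialized normal form is the linear map `(x - ξ)^γ ↦ M^γ[1]`. -/
lemma map_paramNormalForm (ξ : Fin n → ℂ) (p : MvPolynomial (Fin n) ℂ) :
    (fun r => φ (paramNormalForm α ξ p r)) = evalSeq (specVec φ) (translate ξ p) := by
  have hc : ∀ γ, (multiFact γ : ℂ)⁻¹ * derivAt ξ γ p = coeff γ (translate ξ p) := fun γ => by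
    rw [derivAt_eq_scaledCoeff, scaledCoeff_apply, inv_mul_cancel_left₀ (multiFact_ne_zero γ)]
  have h0 : ∀ γ ∉ (translate ξ p).support, coeff γ (translate ξ p) = 0 :=
    fun γ hγ => notMem_support_iff.mp hγ
  rw [evalSeq_eq_sum _ _ (translate ξ p).support fun γ hγ => by rw [h0 γ hγ, zero_smul]]
  simp only [paramNormalForm, hc]
  rw [finsum_eq_sum_of_support_subset (s := (translate ξ p).support)]
  · funext r
    simp [Finset.sum_apply, specVec]
  · intro γ hγ
    by_contra hn
    exact hγ (by simp only; rw [h0 γ hn, zero_smul])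

/-- If the specialized matrices commute and annihilate the system, the vectors `M^γ[1]` are
determined by those with `γ ∈ E`. -/
lemma specVec_eq_sum {N : ℕ} {f : Fin N → MvPolynomial (Fin n) ℂ}
    (h : IsOrthogonalPair (sysIdeal f) Q ξ α Λ)
    (hcomm : ∀ i j, Commute ((paramMatrix α i).map φ) ((paramMatrix α j).map φ))
    (hf : ∀ k r, φ (paramNormalForm α ξ (f k) r) = 0) (γ : Fin n →₀ ℕ) :
    specVec φ γ = ∑ j, scaledCoeff γ (Λ j) • specVec φ (α j) := by
  classical
  -- `ℂ`-linear forms separate the points of `A^δ`, so the vector identity reduces to scalar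
  -- functionals.
  rw [← sub_eq_zero, ← Module.forall_dual_apply_eq_zero_iff ℂ]
  intro l
  have hfin : (Function.support fun γ => (multiFact γ : ℂ)⁻¹ * l (specVec φ γ)).Finite := by
    refine (Finsupp.finite_of_degree_le δ).subset fun γ hγ => ?_
    by_contra hn
    refine hγ ?_
    have : specVec φ γ = 0 := funext fun r => specVec_eq_zero_of_lt_degree φ hcomm
      (r.2.trans (not_le.mp hn))
    simp only
    rw [this, map_zero, mul_zero]
  -- `L` represents the functional `(x - ξ)^γ ↦ l(M^γ[1])`; nilpotency makes the sum finite.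
  let L : MvPolynomial (Fin n) ℂ :=
    ∑ γ ∈ hfin.toFinset, monomial γ ((multiFact γ : ℂ)⁻¹ * l (specVec φ γ))
  have hL : ∀ γ, scaledCoeff γ L = l (specVec φ γ) := by
    intro γ
    have : coeff γ L = (multiFact γ : ℂ)⁻¹ * l (specVec φ γ) := by
      simp only [L, coeff_sum, coeff_monomial, Finset.sum_ite_eq']
      split_ifs with hm
      · rfl
      · rw [Set.Finite.mem_toFinset, Function.notMem_support] at hm
        exact hm.symm
    rw [scaledCoeff_apply, this, mul_inv_cancel_left₀ (multiFact_ne_zero γ)]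
  have hmem : L ∈ dualSpace (sysIdeal f) ξ := by
    intro p hp
    rw [applyAt_eq_evalSeq]
    simp only [hL]
    rw [← map_evalSeq, evalSeq_translate_eq_zero
      (T := fun i => ((paramMatrix α i).map φ).mulVecLin.restrictScalars ℂ)
      (fun i γ => specVec_add_single φ hcomm i γ) (fun k => ?_) hp, map_zero]
    rw [← map_paramNormalForm]
    exact funext fun r => hf k r
  have hexp := h.scaledCoeff_expand hmem γ
  simp only [hL] at hexp
  rw [map_sub, hexp, map_sum, sub_eq_zero]
  exact Finset.sum_congr rfl fun j _ => by rw [map_smul, smul_eq_mul, mul_comm]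

lemma mulVec_single_of_mem (hα : Function.Injective α) {i : Fin n} {j c : Fin δ} (hcj : c < j)
    (h : α j = α c + Finsupp.single i 1) :
    ((paramMatrix α i).map φ).mulVec (Pi.single c 1) = Pi.single j 1 := by
  funext r
  rw [Matrix.mulVec_single_one, Matrix.col_apply, Matrix.map_apply, paramMatrix, Matrix.of_apply]
  have hmem : α c + Finsupp.single i 1 ∈ Set.range α := ⟨j, h⟩
  by_cases hr : r = j
  · subst hr
    simp [hcj, h]
  · have : α r ≠ α c + Finsupp.single i 1 := fun h' => hr (hα (h'.trans h.symm))
    simp [hr, this, hmem]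

/-- If `α_j = α_c + e_i`, then column `c` of `M_i` is `e_j`, so connectedness allows induction on
`j`. The inequality `c < j` is forced: otherwise triangularity would contradict `Λ_j((x - ξ)^{α_j})
= 1`. -/
lemma specVec_basis {N : ℕ} {f : Fin N → MvPolynomial (Fin n) ℂ}
    (h : IsOrthogonalPair (sysIdeal f) Q ξ α Λ)
    (hcomm : ∀ i j, Commute ((paramMatrix α i).map φ) ((paramMatrix α j).map φ)) (j : Fin δ) :
    specVec φ (α j) = Pi.single j 1 := by
  induction j using WellFoundedLT.induction with
  | ind j ih =>
    rcases h.connected j with h0 | ⟨c, i, hc⟩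
    · obtain rfl : j = 0 := h.injective (h0.trans h.first.symm)
      rw [h0, specVec_zero]
    · have hcj : c < j := by
        by_contra hn
        have h1 := h.scaledCoeff_succ_eq_zero (not_lt.mp hn) i
        rw [← hc, h.scaledCoeff_dual, if_pos rfl] at h1
        exact one_ne_zero h1
      rw [hc, ← specVec_add_single φ hcomm, ih c hcj,
        mulVec_single_of_mem φ h.injective hcj hc]

/-! ### The two inclusions -/

variable (α Λ) in
/-- Evaluation of the parameters at `μ = ν`. -/
noncomputable def evalNu : MvPolynomial (ParamIndex α) ℂ →ₐ[ℂ] ℂ :=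
  aeval fun v => dualCoeff Λ v.1.1 v.1.2

/-- Modulo `m_ν` every polynomial is congruent to its value at `ν`. -/
lemma ker_evalNu : RingHom.ker (evalNu α Λ) = paramPointIdeal α Λ := by
  refine le_antisymm (fun p hp => ?_) (Ideal.span_le.mpr ?_)
  · have key : p - C (evalNu α Λ p) ∈ paramPointIdeal α Λ := by
      clear hp
      induction p using MvPolynomial.induction_on with
      | C a => simp [evalNu]
      | add p q hp hq =>
        rw [map_add, map_add, add_sub_add_comm]
        exact add_mem hp hq
      | mul_X p v hp =>
        have hv : X v - C (dualCoeff Λ v.1.1 v.1.2) ∈ paramPointIdeal α Λ :=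
          Ideal.subset_span ⟨v, rfl⟩
        have he : evalNu α Λ (X v) = dualCoeff Λ v.1.1 v.1.2 := by simp [evalNu]
        rw [map_mul, he, map_mul]
        have := add_mem (Ideal.mul_mem_right (X v) _ hp)
          (Ideal.mul_mem_left _ (C (evalNu α Λ p)) hv)
        convert this using 1
        ring
    rwa [RingHom.mem_ker.mp hp, map_zero, sub_zero] at key
  · rintro _ ⟨v, rfl⟩
    simp [evalNu]

lemma paramPointIdeal_isMaximal : (paramPointIdeal α Λ).IsMaximal := by
  rw [← ker_evalNu]
  exact RingHom.ker_isMaximal_of_surjective (evalNu α Λ : MvPolynomial (ParamIndex α) ℂ →+* ℂ)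
    fun a => ⟨C a, by simp [evalNu]⟩

lemma map_evalNu_paramMatrix (h : IsOrthogonalPair I Q ξ α Λ) (i : Fin n) :
    (paramMatrix α i).map (evalNu α Λ) =
      Matrix.of fun r c => scaledCoeff (α c + Finsupp.single i 1) (Λ r) := by
  ext r c
  rw [Matrix.map_apply, Matrix.of_apply]
  rcases le_or_gt r c with hrc | hrc
  · rw [paramMatrix_eq_zero i hrc, map_zero, h.scaledCoeff_succ_eq_zero hrc]
  · simp only [paramMatrix, Matrix.of_apply, dif_pos hrc]
    split_ifs with h1 h2
    · rw [← h1, h.scaledCoeff_dual, if_pos rfl, map_one]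
    · obtain ⟨s, hs⟩ := h2
      rw [← hs, h.scaledCoeff_dual, if_neg, map_zero]
      rintro rfl
      exact h1 hs
    · simp [evalNu, dualCoeff, scaledCoeff_apply]

/-- Row `r` of `M_i(ν)` holds the coordinates of `∂_i Λ_r` in the dual basis. -/
lemma evalNu_mulVec (h : IsOrthogonalPair I Q ξ α Λ) (i : Fin n) (β : Fin n →₀ ℕ) :
    ((paramMatrix α i).map (evalNu α Λ)).mulVec (fun r => scaledCoeff β (Λ r)) =
      fun r => scaledCoeff (β + Finsupp.single i 1) (Λ r) := by
  funext r
  have := h.scaledCoeff_expand (pderiv_mem_dualSpace (h.dual_mem r) i) β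
  simp only [scaledCoeff_pderiv] at this
  rw [this, map_evalNu_paramMatrix h]
  rfl

lemma commute_evalNu (h : IsOrthogonalPair I Q ξ α Λ) (i j : Fin n) :
    Commute ((paramMatrix α i).map (evalNu α Λ)) ((paramMatrix α j).map (evalNu α Λ)) := by
  have key : ∀ i j : Fin n, ∀ c, ((paramMatrix α i).map (evalNu α Λ) *
      (paramMatrix α j).map (evalNu α Λ)).mulVec (Pi.single c 1) =
        fun r => scaledCoeff (α c + Finsupp.single j 1 + Finsupp.single i 1) (Λ r) := by
    intro i j c
    have hc : (Pi.single c 1 : Fin δ → ℂ) = fun r => scaledCoeff (α c) (Λ r) := by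
      funext r
      rw [h.scaledCoeff_dual, Pi.single_apply]
    rw [← Matrix.mulVec_mulVec, hc, evalNu_mulVec h, evalNu_mulVec h]
  -- Both products send `e_c` to the values of the `Λ_r` at the exponent `α_c + e_i + e_j`.
  refine Matrix.ext_of_mulVec_single fun c => ?_
  rw [key, key, add_right_comm]

lemma specVec_evalNu (h : IsOrthogonalPair I Q ξ α Λ) (γ : Fin n →₀ ℕ) :
    specVec (evalNu α Λ) γ = fun r => scaledCoeff γ (Λ r) := by
  induction hd : γ.degree generalizing γ with
  | zero =>
    obtain rfl := (Finsupp.degree_eq_zero_iff γ).mp hd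
    rw [specVec_zero]
    funext r
    rw [← h.first, h.scaledCoeff_dual, Pi.single_apply]
  | succ d ih =>
    have hne : γ ≠ 0 := by rintro rfl; simp at hd
    obtain ⟨i, hi⟩ := Finsupp.ne_iff.mp hne
    have hle : Finsupp.single i 1 ≤ γ := by
      rw [Finsupp.single_le_iff]
      exact Nat.one_le_iff_ne_zero.mpr hi
    obtain ⟨γ', rfl⟩ := exists_add_of_le hle
    rw [add_comm] at hd ⊢
    rw [map_add, Finsupp.degree_single] at hd
    rw [← specVec_add_single _ (commute_evalNu h), ih γ' (by omega), evalNu_mulVec h]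

lemma structureIdeal_le {N : ℕ} {f : Fin N → MvPolynomial (Fin n) ℂ}
    (h : IsOrthogonalPair (sysIdeal f) Q ξ α Λ) :
    structureIdeal f ξ α ≤ paramPointIdeal α Λ := by
  rw [← ker_evalNu]
  refine Ideal.span_le.mpr ?_
  rintro _ (⟨k, r, rfl⟩ | ⟨i, j, r, c, rfl⟩)
  · have h1 := congrFun (map_paramNormalForm (evalNu α Λ) ξ (f k)) r
    have h2 := map_evalSeq (LinearMap.proj r) (specVec (evalNu α Λ)) (translate ξ (f k))
    simp only [LinearMap.proj_apply, specVec_evalNu h] at h2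
    rw [← applyAt_eq_evalSeq, h.dual_mem r _ (Ideal.subset_span ⟨k, rfl⟩)] at h2
    rw [SetLike.mem_coe, RingHom.mem_ker]
    exact h1.trans h2
  · have h1 := congrFun (congrFun (commute_evalNu h i j).eq r) c
    rw [← Matrix.map_mul, ← Matrix.map_mul, Matrix.map_apply, Matrix.map_apply] at h1
    rw [SetLike.mem_coe, RingHom.mem_ker, Matrix.sub_apply, map_sub, h1, sub_self]

lemma paramPointIdeal_le {N : ℕ} {f : Fin N → MvPolynomial (Fin n) ℂ}
    (h : IsOrthogonalPair (sysIdeal f) Q ξ α Λ) :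
    paramPointIdeal α Λ ≤ structureIdeal f ξ α := by
  let φ := Ideal.Quotient.mkₐ ℂ (structureIdeal f ξ α)
  have hφ : ∀ g ∈ structureIdeal f ξ α, φ g = 0 := fun g hg => Ideal.Quotient.eq_zero_iff_mem.mpr hg
  have hf : ∀ k r, φ (paramNormalForm α ξ (f k) r) = 0 :=
    fun k r => hφ _ (Ideal.subset_span (Or.inl ⟨k, r, rfl⟩))
  have hcomm : ∀ i j, Commute ((paramMatrix α i).map φ) ((paramMatrix α j).map φ) := by
    intro i j
    ext r c
    rw [← Matrix.map_mul, ← Matrix.map_mul, Matrix.map_apply, Matrix.map_apply, ← sub_eq_zero,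
      ← map_sub, ← Matrix.sub_apply]
    exact hφ _ (Ideal.subset_span (Or.inr ⟨i, j, r, c, rfl⟩))
  refine Ideal.span_le.mpr ?_
  rintro _ ⟨⟨⟨r, β⟩, hβ, c, hcr, i, hci⟩, rfl⟩
  obtain rfl : β = α c + Finsupp.single i 1 := hci
  -- The left side becomes the entry `(r, c)` of `M_i`, the class of a parameter; the right side
  -- becomes the scalar `Λ_r((x - ξ)^{α_c + e_i})`.
  have h1 := congrFun (specVec_eq_sum φ h hcomm hf (α c + Finsupp.single i 1)) r
  rw [← specVec_add_single φ hcomm] at h1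
  simp only [specVec_basis φ h hcomm] at h1
  have hne : α r ≠ α c + Finsupp.single i 1 := fun h => hβ ⟨r, h⟩
  rw [Matrix.mulVec_single_one, Matrix.col_apply, Matrix.map_apply, paramMatrix, Matrix.of_apply,
    dif_pos hcr, if_neg hne, dif_neg hβ] at h1
  simp only [Finset.sum_apply, Pi.smul_apply, Pi.single_apply, smul_ite, smul_zero,
    Finset.sum_ite_eq, Finset.mem_univ, if_true] at h1
  rw [SetLike.mem_coe, ← Ideal.Quotient.eq_zero_iff_mem, map_sub, sub_eq_zero]
  refine h1.trans ?_
  rw [← Algebra.algebraMap_eq_smul_one]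
  rfl

end Pair

end MultStructure

theorem mainTheorem3 (K : Subfield ℂ) (n N δ : ℕ) [NeZero δ]
    (f : Fin N → MvPolynomial (Fin n) K) (F : Fin N → MvPolynomial (Fin n) ℂ)
    (hF : ∀ k, F k = MvPolynomial.map K.subtype (f k))
    (ξ : Fin n → ℂ) (hξ : MultStructure.IsIsolatedSolution F ξ)
    (Q : Ideal (MvPolynomial (Fin n) ℂ))
    (hQ : MultStructure.IsPrimaryComponentAt (MultStructure.sysIdeal F) ξ Q)
    (α : Fin δ → Fin n →₀ ℕ) (Λ : Fin δ → MvPolynomial (Fin n) ℂ)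
    (hpair : MultStructure.IsOrthogonalPair (MultStructure.sysIdeal F) Q ξ α Λ) :
    MultStructure.structureIdeal F ξ α = MultStructure.paramPointIdeal α Λ ∧
      (MultStructure.paramPointIdeal α Λ).IsMaximal :=
  ⟨le_antisymm (MultStructure.structureIdeal_le hpair) (MultStructure.paramPointIdeal_le hpair),
    MultStructure.paramPointIdeal_isMaximal⟩
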